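/- Let $H$ be a complex Hilbert space with inner product $\langle\cdot,\cdot\rangle$ linear in the first variable. A resolution of the identity (on $\mathbb R$) is a family $\{X(\lambda)\}_{\lambda\in\mathbb R}$ of bounded, not necessarily self-adjoint, operators on $H$ such that (1) $\gamma(X):=\sup_{\lambda}\|X(\lambda)\|<\infty$; (2) $X(\lambda)X(\mu)=X(\mu)X(\lambda)=X(\lambda)$ whenever $\lambda<\mu$; (3) $\lim_{\lambda\to-\infty}X(\lambda)\xi=0$ and $\lim_{\lambda\to+\infty}X(\lambda)\xi=\xi$ for every $\xi\in H$; (4) $\lim_{\varepsilon\to0^+}X(\lambda+\varepsilon)\xi=X(\lambda)\xi$ for all $\lambda\in\mathbb R$, $\xi\in H$. It is a *-resolution of the identity if $\{X(\lambda)^*\}_{\lambda\in\mathbb R}$ is a resolution of the identity as well. Theorem. Let $\{X(\lambda)\}_{\lambda\in\mathbb R}$ be a *-resolution of the identity with $\gamma(X)=1$, and let $F(\lambda)=X(\lambda)^*X(\lambda)$. For $\xi\in H$ let $d\langle F(\lambda)\xi,\xi\rangle$ be the positive Borel measure on $\mathbb R$ defined by the increasing right-continuous function $\lambda\mapsto\langle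 F(\lambda)\xi,\xi\rangle$. Put $$D(T_X)=\Big\{\xi\in H:\ \int_{\mathbb R}\lambda^2\,d\langle F(\lambda)\xi,\xi\rangle<\infty\Big\}.$$ Then $D(T_X)$ is dense in $H$, and there exists a unique closed symmetric (that is, densely defined with $\langle T_X\xi,\xi'\rangle=\langle\xi,T_X\xi'\rangle$ for all $\xi,\xi'\in D(T_X)$) linear operator $T_X$ with domain exactly $D(T_X)$ such that, for all $\xi\in D(T_X)$ and $\eta\in H$, the function $\lambda\mapsto\langle F(\lambda)\xi,\eta\rangle$ is of bounded variation on $\mathbb R$, $\lambda$ is integrable with respect to the complex Borel measure $d\langle F(\lambda)\xi,\eta\rangle$ that it defines, and $$\langle T_X\xi,\eta\rangle=\int_{\mathbb R}\lambda\,d\langle F(\lambda)\xi,\eta\rangle .$$ -/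

import Mathlib

open Filter Topology MeasureTheory

/-- A resolution of the identity on the real line, by bounded operators on a complex Hilbert space
that need not be self-adjoint. -/
structure IsResolutionOfIdentity {H : Type*} [NormedAddCommGroup H] [InnerProductSpace ℂ H]
    (X : ℝ → H →L[ℂ] H) : Prop where
  bddAbove_norm : BddAbove (Set.range fun l : ℝ => ‖X l‖)
  comp_of_lt : ∀ l m : ℝ, l < m → X l ∘L X m = X l ∧ X m ∘L X l = X l
  tendsto_atBot : ∀ ξ : H, Tendsto (fun l : ℝ => X l ξ) atBot (𝓝 0)
  tendsto_atTop : ∀ ξ : H, Tendsto (fun l : ℝ => X l ξ) atTop (𝓝 ξ)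
  right_continuous : ∀ (l : ℝ) (ξ : H), Tendsto (fun ε : ℝ => X (l + ε) ξ) (𝓝[>] 0) (𝓝 (X l ξ))

/-- A *-resolution of the identity: both `X` and the family of adjoints are resolutions of the
identity. -/
structure IsStarResolutionOfIdentity {H : Type*} [NormedAddCommGroup H] [InnerProductSpace ℂ H]
    [CompleteSpace H] (X : ℝ → H →L[ℂ] H) : Prop where
  isResolution : IsResolutionOfIdentity X
  isResolution_adjoint : IsResolutionOfIdentity fun l : ℝ => ContinuousLinearMap.adjoint (X l)

/-- `γ(X) = sup_l ‖X(l)‖`. -/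
noncomputable def resolutionBound {H : Type*} [NormedAddCommGroup H] [InnerProductSpace ℂ H]
    (X : ℝ → H →L[ℂ] H) : ℝ :=
  ⨆ l : ℝ, ‖X l‖

/-- `F(l) = X(l)* X(l)`. -/
noncomputable def positiveFamily {H : Type*} [NormedAddCommGroup H] [InnerProductSpace ℂ H]
    [CompleteSpace H] (X : ℝ → H →L[ℂ] H) (l : ℝ) : H →L[ℂ] H :=
  ContinuousLinearMap.adjoint (X l) ∘L X l

theorem re_inner_positiveFamily {H : Type*} [NormedAddCommGroup H] [InnerProductSpace ℂ H]
    [CompleteSpace H] (X : ℝ → H →L[ℂ] H) (ξ : H) (l : ℝ) :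
    (inner ℂ ξ (positiveFamily X l ξ)).re = ‖X l ξ‖ ^ 2 := by
  rw [positiveFamily, ContinuousLinearMap.comp_apply, ContinuousLinearMap.adjoint_inner_right]
  exact inner_self_eq_norm_sq (𝕜 := ℂ) (X l ξ)

theorem monotone_re_inner_positiveFamily {H : Type*} [NormedAddCommGroup H]
    [InnerProductSpace ℂ H] [CompleteSpace H] {X : ℝ → H →L[ℂ] H} (hX : IsResolutionOfIdentity X)
    (hγ : resolutionBound X = 1) (ξ : H) :
    Monotone fun l : ℝ => (inner ℂ ξ (positiveFamily X l ξ)).re := by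
  intro l m hlm
  simp only [re_inner_positiveFamily]
  rcases hlm.eq_or_lt with rfl | hlt
  · exact le_rfl
  have h1 : ‖X l‖ ≤ 1 := hγ ▸ le_ciSup hX.bddAbove_norm l
  have h2 : X l (X m ξ) = X l ξ := congrArg (fun A : H →L[ℂ] H => A ξ) (hX.comp_of_lt l m hlt).1
  have h3 : ‖X l ξ‖ ≤ ‖X m ξ‖ := by
    rw [← h2]
    exact (X l).le_of_opNorm_le h1 (X m ξ) |>.trans_eq (one_mul _)
  gcongr

theorem continuousWithinAt_re_inner_positiveFamily {H : Type*} [NormedAddCommGroup H]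
    [InnerProductSpace ℂ H] [CompleteSpace H] {X : ℝ → H →L[ℂ] H} (hX : IsResolutionOfIdentity X)
    (ξ : H) (l : ℝ) :
    ContinuousWithinAt (fun l : ℝ => (inner ℂ ξ (positiveFamily X l ξ)).re) (Set.Ici l) l := by
  simp only [re_inner_positiveFamily]
  rw [← continuousWithinAt_Ioi_iff_Ici]
  have h1 : Tendsto (fun m : ℝ => m - l) (𝓝[>] l) (𝓝[>] 0) := by
    refine tendsto_nhdsWithin_iff.2 ⟨?_, ?_⟩
    · have : Tendsto (fun m : ℝ => m - l) (𝓝 l) (𝓝 (l - l)) :=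
        (continuous_id.sub continuous_const).tendsto l
      rw [sub_self] at this
      exact this.mono_left nhdsWithin_le_nhds
    · filter_upwards [self_mem_nhdsWithin] with m hm using sub_pos.2 (Set.mem_Ioi.1 hm)
  have h2 := (((hX.right_continuous l ξ).comp h1).norm).pow 2
  simpa [ContinuousWithinAt, Function.comp_def] using h2

/-- The positive measure `d⟨F(l)ξ, ξ⟩` on the line: `(a, b]` has mass
`⟨F(b)ξ, ξ⟩ - ⟨F(a)ξ, ξ⟩`. -/
noncomputable def diagonalMeasure {H : Type*} [NormedAddCommGroup H] [InnerProductSpace ℂ H]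
    [CompleteSpace H] {X : ℝ → H →L[ℂ] H} (hX : IsStarResolutionOfIdentity X)
    (hγ : resolutionBound X = 1) (ξ : H) : Measure ℝ :=
  StieltjesFunction.measure
    { toFun := fun l : ℝ => (inner ℂ ξ (positiveFamily X l ξ)).re
      mono' := monotone_re_inner_positiveFamily hX.isResolution hγ ξ
      right_continuous' := continuousWithinAt_re_inner_positiveFamily hX.isResolution ξ }

/-- The set of all `ξ` with `∫ l² d⟨F(l)ξ, ξ⟩ < ∞`. -/
def squareIntegrableDomain {H : Type*} [NormedAddCommGroup H] [InnerProductSpace ℂ H]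
    [CompleteSpace H] {X : ℝ → H →L[ℂ] H} (hX : IsStarResolutionOfIdentity X)
    (hγ : resolutionBound X = 1) : Set H :=
  {ξ : H | ∫⁻ l : ℝ, ENNReal.ofReal (l ^ 2) ∂(diagonalMeasure hX hγ ξ) < ⊤}

/-- The integral `∫ g(l) df(l)` exists and equals `z`: `f` is of bounded variation, `g` is
integrable with respect to (the total variation of) the complex Borel measure `df` and the integral
is `z`. For right continuous `f` this measure gives `(a, b]` the mass `f(b) - f(a)`. -/
def HasStieltjesIntegral (g : ℝ → ℝ) (f : ℝ → ℂ) (z : ℂ) : Prop :=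
  ∃ hf : BoundedVariationOn f Set.univ,
    hf.vectorMeasure.Integrable g ∧ ∫ᵛ l, g l ∂•hf.vectorMeasure = z

/-- An operator `T`, defined on a subspace of `H`, is symmetric if its domain is dense and
`⟨Tξ, η⟩ = ⟨ξ, Tη⟩` for all `ξ`, `η` in the domain. -/
def IsSymmetricOperator {H : Type*} [NormedAddCommGroup H] [InnerProductSpace ℂ H]
    (T : H →ₗ.[ℂ] H) : Prop :=
  Dense (T.domain : Set H) ∧ T.IsFormalAdjoint T

/-! The bound `γ(X) = 1` makes each `X l` a contractive idempotent, hence an orthogonal projection,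
so `F = X` is an ordinary spectral family and the claim becomes the spectral theorem for `T = ∫ l
dX(l)`.

Write `μ_ξ` for the diagonal measure. The inner product of `X a ξ` and `X b ξ` is `μ_ξ (Iic a ∩ Iic
b)`, so sending the indicator of `Iic a` to `X a ξ` extends to an isometry `spectralMap` from
`L²(μ_ξ)` into `H`. The domain condition says that the coordinate function `x` lies in `L²(μ_ξ)`,
and `T ξ` is its image. Identities between such images are checked on half-lines, whose indicators
span a dense subspace.

The truncations `E_n = X n - X (-n)` map into the domain and tend strongly to the identity, which
gives density. `T` is symmetric because its quadratic form is real. Closedness follows from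
self-adjointness: for `η` in the domain of `T†`, `T (E_n η) = E_n (T† η)` is bounded in `n`, which
forces `∫ l² dμ_η < ∞`.

By Riesz, `d⟨Fξ, η⟩` has an `L²` density with respect to `μ_ξ`, so `x` is integrable against it and
the formula holds. The formula determines `T ξ`, hence uniqueness. -/

section General

open Set

/-! ### Contractive idempotents, vector measures with density, and half-lines in `L²`. -/

/-- A contractive idempotent on a Hilbert space is self-adjoint. -/
theorem ContinuousLinearMap.inner_apply_left_of_idempotent_of_norm_le_one {H : Type*}
    [NormedAddCommGroup H] [InnerProductSpace ℂ H] (P : H →L[ℂ] H)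
    (hP : ∀ x, P (P x) = P x) (h1 : ‖P‖ ≤ 1) (x y : H) :
    inner ℂ (P x) y = inner ℂ x (P y) := by
  -- Range and kernel are orthogonal: contractivity makes `u` the shortest vector of `u + ℂ v`.
  have key : ∀ u v : H, P u = u → P v = 0 → inner ℂ u v = 0 := by
    intro u v hu hv
    by_contra hne
    have hmin : ∀ c : ℂ, ‖u‖ ^ 2 ≤ ‖u + c • v‖ ^ 2 := by
      intro c
      have : ‖P (u + c • v)‖ ≤ 1 * ‖u + c • v‖ := P.le_of_opNorm_le h1 _
      rw [map_add, map_smul, hu, hv, smul_zero, add_zero, one_mul] at this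
      gcongr
    have hpos : 0 < ‖(inner ℂ u v : ℂ)‖ ^ 2 := by positivity
    set a := ‖(inner ℂ u v : ℂ)‖ ^ 2 with ha
    have hquad : ∀ t : ℝ, 0 ≤ -(2 * t * a) + t ^ 2 * a * ‖v‖ ^ 2 := by
      intro t
      -- This phase makes the cross term the real number `-2ta`.
      have h2 := hmin (-(t : ℂ) * (starRingEnd ℂ) (inner ℂ u v))
      rw [norm_add_sq (𝕜 := ℂ), inner_smul_right, norm_smul, mul_pow, norm_mul, norm_neg,
        mul_assoc, mul_comm ((starRingEnd ℂ) _), Complex.mul_conj, Complex.normSq_eq_norm_sq,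
        ← ha, mul_pow, RCLike.norm_conj, ← ha, Complex.norm_real, Real.norm_eq_abs, sq_abs] at h2
      have h3 : RCLike.re (-(t : ℂ) * (a : ℂ)) = -(t * a) := by
        rw [← Complex.ofReal_neg, ← Complex.ofReal_mul]
        simp
      rw [h3] at h2
      linarith
    -- Any small `t > 0` makes the quadratic negative; the `+ 1` avoids dividing by zero.
    have h4 := hquad (1 / (‖v‖ ^ 2 + 1))
    have hv' : 0 < ‖v‖ ^ 2 + 1 := by positivity
    have h5 : -(2 * (1 / (‖v‖ ^ 2 + 1)) * a) + (1 / (‖v‖ ^ 2 + 1)) ^ 2 * a * ‖v‖ ^ 2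
        = -(a * (‖v‖ ^ 2 + 2)) / (‖v‖ ^ 2 + 1) ^ 2 := by
      field_simp
      ring
    rw [h5] at h4
    have : -(a * (‖v‖ ^ 2 + 2)) / (‖v‖ ^ 2 + 1) ^ 2 < 0 := by
      apply div_neg_of_neg_of_pos
      · nlinarith [sq_nonneg ‖v‖]
      · positivity
    linarith
  have e1 : inner ℂ (P x) (y - P y) = 0 := key _ _ (hP x) (by rw [map_sub, hP, sub_self])
  have e2 : inner ℂ (P y) (x - P x) = 0 := key _ _ (hP y) (by rw [map_sub, hP, sub_self])
  have e3 : inner ℂ (x - P x) (P y) = 0 := by rw [← inner_conj_symm, e2, map_zero]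
  rw [inner_sub_right, sub_eq_zero] at e1
  rw [inner_sub_left, sub_eq_zero] at e3
  rw [e1, e3]

/-- A function whose increments are dominated by those of a bounded monotone function has bounded
variation. -/
theorem BoundedVariationOn.of_norm_sub_le {f : ℝ → ℂ} {G : ℝ → ℝ} {C : ℝ} (hG : Monotone G)
    (hC : ∀ x, |G x| ≤ C) (hfG : ∀ x y, x ≤ y → ‖f y - f x‖ ≤ G y - G x) :
    BoundedVariationOn f univ := by
  have h1 : BoundedVariationOn G univ := (hG.monotoneOn univ).boundedVariationOn fun x _ => hC x
  refine ne_top_of_le_ne_top h1 (iSup_le fun p => ?_)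
  refine le_trans (Finset.sum_le_sum fun i _ => ?_)
    (eVariationOn.sum_le (f := G) (s := univ) (n := p.1) p.2.2.1 fun i => mem_univ _)
  have hle : p.2.1 i ≤ p.2.1 (i + 1) := p.2.2.1 (Nat.le_succ i)
  rw [edist_dist, edist_dist, dist_eq_norm, Real.dist_eq]
  exact ENNReal.ofReal_le_ofReal ((hfG _ _ hle).trans (le_abs_self _))

/-- Integrability with respect to the vector measure with density `g`. -/
theorem MeasureTheory.integrable_withDensityᵥ_iff {μ : Measure ℝ} {g : ℝ → ℂ}
    (hg : Integrable g μ) {h : ℝ → ℝ} :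
    (μ.withDensityᵥ g).Integrable h ↔ Integrable (fun x => ‖g x‖ * h x) μ := by
  rw [VectorMeasure.Integrable, Measure.variation_withDensityᵥ hg,
    integrable_withDensity_iff_integrable_smul₀' hg.aestronglyMeasurable.enorm (by simp)]
  simp

/-- The integral against the vector measure with density `g` is the integral of the product. -/
theorem MeasureTheory.integral_withDensityᵥ {μ : Measure ℝ} {g : ℝ → ℂ} (hg : Integrable g μ)
    {h : ℝ → ℝ} (hh : (μ.withDensityᵥ g).Integrable h) :
    ∫ᵛ x, h x ∂•(μ.withDensityᵥ g) = ∫ x, h x • g x ∂μ := by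
  have hvar : (μ.withDensityᵥ g).variation = μ.withDensity (fun x => ‖g x‖ₑ) :=
    Measure.variation_withDensityᵥ hg
  have hint : ∀ k : ℝ → ℝ, (μ.withDensityᵥ g).Integrable k → Integrable (fun x => k x • g x) μ := by
    intro k hk
    rw [integrable_withDensityᵥ_iff hg] at hk
    refine hk.mono ?_ (ae_of_all _ fun x => by simp [mul_comm])
    -- `k` need not be `μ`-measurable where `g = 0`, so `k • g` is recovered as `(‖g‖ k) • (g /
    -- ‖g‖)`.
    refine (hk.aestronglyMeasurable.smul
      (hg.aestronglyMeasurable.norm.inv₀.smul hg.aestronglyMeasurable)).congr (ae_of_all _ fun x => ?_)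
    rcases eq_or_ne (g x) 0 with hx | hx
    · simp [hx]
    · have : ‖g x‖ ≠ 0 := norm_ne_zero_iff.2 hx
      change (‖g x‖ * k x) • ‖g x‖⁻¹ • g x = k x • g x
      rw [smul_smul]
      congr 1
      field_simp
  refine Integrable.induction (P := fun k : ℝ → ℝ =>
    ∫ᵛ x, k x ∂•(μ.withDensityᵥ g) = ∫ x, k x • g x ∂μ) ?_ ?_ ?_ ?_ hh
  · intro c s hs hfin
    have : IsFiniteMeasure ((μ.withDensityᵥ g).variation.restrict s) :=
      isFiniteMeasure_restrict.2 hfin.ne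
    rw [VectorMeasure.integral_indicator_const _ hs, withDensityᵥ_apply hg hs,
      ContinuousLinearMap.lsmul_apply, ← integral_smul, ← integral_indicator hs]
    congr 1 with x
    by_cases hx : x ∈ s <;> simp [hx]
  · intro k l _ hk hl hk' hl'
    simp only [Pi.add_apply]
    rw [VectorMeasure.integral_fun_add hk hl, hk', hl', ← integral_add (hint _ hk) (hint _ hl)]
    simp only [add_smul]
  -- The right side is 1-Lipschitz in `k` for the `L¹` norm of the variation `‖g‖ μ`.
  · refine isClosed_eq VectorMeasure.continuous_integral (LipschitzWith.continuous (K := 1) ?_)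
    refine LipschitzWith.of_dist_le_mul fun k l => ?_
    have hk : (μ.withDensityᵥ g).Integrable k := L1.integrable_coeFn k
    have hl : (μ.withDensityᵥ g).Integrable l := L1.integrable_coeFn l
    rw [NNReal.coe_one, one_mul, dist_eq_norm, dist_eq_norm,
      ← integral_sub (hint _ hk) (hint _ hl), L1.norm_eq_integral_norm]
    have h1 : ∫ x, ‖(k - l) x‖ ∂(μ.withDensityᵥ g).variation
        = ∫ x, ‖k x - l x‖ ∂(μ.withDensityᵥ g).variation := by
      refine integral_congr_ae ?_
      filter_upwards [Lp.coeFn_sub k l] with x hx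
      rw [hx, Pi.sub_apply]
    have h2 : ∀ m : ℝ → ℝ, ∫ x, m x ∂(μ.withDensityᵥ g).variation = ∫ x, ‖g x‖ₑ.toReal • m x ∂μ := by
      intro m
      rw [hvar, integral_withDensity_eq_integral_toReal_smul₀ hg.aestronglyMeasurable.enorm
        (by simp)]
    rw [h1, h2]
    refine (norm_integral_le_integral_norm _).trans_eq (integral_congr_ae (ae_of_all _ fun x => ?_))
    simp only [← sub_smul, norm_smul, toReal_enorm, smul_eq_mul]
    exact mul_comm _ _
  · intro k l hkl hk hk'
    rw [← VectorMeasure.integral_congr_ae hkl, hk']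
    refine integral_congr_ae ?_
    rw [hvar, EventuallyEq, ae_withDensity_iff' hg.aestronglyMeasurable.enorm] at hkl
    filter_upwards [hkl] with x hx
    rcases eq_or_ne (g x) 0 with h0 | h0
    · simp [h0]
    · rw [hx (by simpa using h0)]

/-- The span of the indicators of the half-lines `(-∞, a]` is dense in `L²`. -/
theorem MeasureTheory.denseRange_linearCombination_indicator_Iic (μ : Measure ℝ)
    [IsFiniteMeasure μ] :
    DenseRange (Finsupp.linearCombination ℂ fun a : ℝ =>
      indicatorConstLp 2 (measurableSet_Iic (a := a)) (measure_ne_top μ _) (1 : ℂ)) := by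
  rw [DenseRange, ← LinearMap.coe_range, Finsupp.range_linearCombination,
    Submodule.dense_iff_topologicalClosure_eq_top, Submodule.topologicalClosure_eq_top_iff,
    Submodule.eq_bot_iff]
  intro f hf
  have hfi : Integrable f μ := (Lp.memLp f).integrable (by norm_num)
  have h1 : ∀ a : ℝ, ∫ x in Iic a, f x ∂μ = 0 := by
    intro a
    rw [← L2.inner_indicatorConstLp_one (𝕜 := ℂ) measurableSet_Iic (measure_ne_top μ _)]
    exact hf _ (Submodule.subset_span ⟨a, rfl⟩)
  -- A function orthogonal to all half-lines gives a complex measure vanishing on a π-system; the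
  -- whole line is not in it and is reached as a limit.
  have h2 : μ.withDensityᵥ f = μ.withDensityᵥ (0 : ℝ → ℂ) := by
    refine VectorMeasure.ext_of_generateFrom (range Iic) ?_
      ((BorelSpace.measurable_eq (α := ℝ)).trans (borel_eq_generateFrom_Iic ℝ)) isPiSystem_Iic ?_
    · rintro _ ⟨a, rfl⟩
      rw [withDensityᵥ_apply hfi measurableSet_Iic, h1, withDensityᵥ_zero]
      rfl
    · rw [withDensityᵥ_apply hfi .univ, withDensityᵥ_zero]
      have h3 : Tendsto (fun n : ℕ => ∫ x in Iic (n : ℝ), f x ∂μ) atTop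
          (𝓝 (∫ x in ⋃ n : ℕ, Iic (n : ℝ), f x ∂μ)) :=
        tendsto_setIntegral_of_monotone (fun _ => measurableSet_Iic)
          (fun m n hmn => Iic_subset_Iic.2 (by exact_mod_cast hmn)) hfi.integrableOn
      have h4 : ⋃ n : ℕ, Iic (n : ℝ) = univ := by
        refine eq_univ_of_forall fun x => ?_
        obtain ⟨n, hn⟩ := exists_nat_ge x
        exact mem_iUnion.2 ⟨n, hn⟩
      rw [h4] at h3
      simp only [h1] at h3
      exact tendsto_nhds_unique h3 tendsto_const_nhds |>.trans rfl
  have h5 : f =ᵐ[μ] (0 : ℝ → ℂ) := hfi.ae_eq_of_withDensityᵥ_eq (integrable_zero _ _ _) h2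
  exact (Lp.eq_zero_iff_ae_eq_zero).2 h5

/-- The restriction map `L²(μ) → L²(ν)` for `ν ≤ μ`. -/
noncomputable def MeasureTheory.Lp.restrictMeasure {μ ν : Measure ℝ} (h : ν ≤ μ) :
    Lp ℂ 2 μ →L[ℂ] Lp ℂ 2 ν :=
  LinearMap.mkContinuous
    { toFun := fun f => ((Lp.memLp f).mono_measure h).toLp f
      map_add' := fun f g => by
        rw [← MemLp.toLp_add]
        exact MemLp.toLp_congr _ _ ((Measure.absolutelyContinuous_of_le h).ae_eq (Lp.coeFn_add f g))
      map_smul' := fun c f => by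
        rw [RingHom.id_apply, ← MemLp.toLp_const_smul]
        exact MemLp.toLp_congr _ _
          ((Measure.absolutelyContinuous_of_le h).ae_eq (Lp.coeFn_smul c f)) } 1 fun f => by
    rw [one_mul]
    change ‖((Lp.memLp f).mono_measure h).toLp f‖ ≤ ‖f‖
    rw [Lp.norm_toLp, Lp.norm_def]
    exact ENNReal.toReal_mono (Lp.eLpNorm_ne_top f) (eLpNorm_mono_measure f h)

theorem MeasureTheory.Lp.restrictMeasure_toLp {μ ν : Measure ℝ} (h : ν ≤ μ) {f : ℝ → ℂ}
    (hf : MemLp f 2 μ) :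
    Lp.restrictMeasure h (hf.toLp f) = (hf.mono_measure h).toLp f :=
  MemLp.toLp_congr ((Lp.memLp (hf.toLp f)).mono_measure h) _
    ((Measure.absolutelyContinuous_of_le h).ae_eq hf.coeFn_toLp)

end General

/-! ### The family consists of orthogonal projections. -/

section Projections

variable {H : Type*} [NormedAddCommGroup H] [InnerProductSpace ℂ H] {X : ℝ → H →L[ℂ] H}

theorem IsResolutionOfIdentity.apply_apply (hX : IsResolutionOfIdentity X) (l m : ℝ) (ξ : H) :
    X l (X m ξ) = X (min l m) ξ := by
  rcases lt_trichotomy l m with h | rfl | h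
  · rw [min_eq_left h.le]
    exact congrArg (fun A : H →L[ℂ] H => A ξ) (hX.comp_of_lt l m h).1
  · rw [min_self]
    -- The axiom covers only distinct indices; idempotence comes from right continuity.
    have h1 : Tendsto (fun ε : ℝ => X l (X (l + ε) ξ)) (𝓝[>] 0) (𝓝 (X l (X l ξ))) :=
      ((X l).continuous.tendsto _).comp (hX.right_continuous l ξ)
    refine tendsto_nhds_unique h1 (tendsto_const_nhds.congr' ?_)
    filter_upwards [self_mem_nhdsWithin] with ε hε
    exact (congrArg (fun A : H →L[ℂ] H => A ξ)
      (hX.comp_of_lt l (l + ε) (lt_add_of_pos_right l hε)).1).symm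
  · rw [min_eq_right h.le]
    exact congrArg (fun A : H →L[ℂ] H => A ξ) (hX.comp_of_lt m l h).2

theorem IsResolutionOfIdentity.inner_apply_left (hX : IsResolutionOfIdentity X)
    (hγ : resolutionBound X = 1) (l : ℝ) (ξ η : H) :
    inner ℂ (X l ξ) η = inner ℂ ξ (X l η) :=
  (X l).inner_apply_left_of_idempotent_of_norm_le_one
    (fun x => by rw [hX.apply_apply, min_self]) (hγ ▸ le_ciSup hX.bddAbove_norm l) ξ η

theorem IsResolutionOfIdentity.positiveFamily_apply [CompleteSpace H]
    (hX : IsResolutionOfIdentity X) (hγ : resolutionBound X = 1) (l : ℝ) (ξ : H) :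
    positiveFamily X l ξ = X l ξ := by
  refine ext_inner_left ℂ fun η => ?_
  rw [positiveFamily, ContinuousLinearMap.comp_apply, ContinuousLinearMap.adjoint_inner_right,
    hX.inner_apply_left hγ, hX.apply_apply, min_self]

theorem IsResolutionOfIdentity.inner_apply_self (hX : IsResolutionOfIdentity X)
    (hγ : resolutionBound X = 1) (l : ℝ) (ξ : H) :
    inner ℂ ξ (X l ξ) = ((‖X l ξ‖ ^ 2 : ℝ) : ℂ) := by
  have h : X l ξ = X l (X l ξ) := by rw [hX.apply_apply, min_self]
  rw [h, ← hX.inner_apply_left hγ, inner_self_eq_norm_sq_to_K, ← h]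
  simp

end Projections

/-! ### The diagonal measures and the isometry from `L²` into `H`. -/

section Diagonal

open Set

variable {H : Type*} [NormedAddCommGroup H] [InnerProductSpace ℂ H] [CompleteSpace H]
  {X : ℝ → H →L[ℂ] H} (hX : IsStarResolutionOfIdentity X) (hγ : resolutionBound X = 1)

theorem diagonalMeasure_Iic (ξ : H) (a : ℝ) :
    diagonalMeasure hX hγ ξ (Iic a) = ENNReal.ofReal (‖X a ξ‖ ^ 2) := by
  have h0 : Tendsto (fun l : ℝ => (inner ℂ ξ (positiveFamily X l ξ)).re) atBot (𝓝 0) := by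
    simp only [re_inner_positiveFamily]
    simpa using ((hX.isResolution.tendsto_atBot ξ).norm).pow 2
  rw [diagonalMeasure, StieltjesFunction.measure_Iic _ h0, sub_zero]
  exact congrArg _ (re_inner_positiveFamily X ξ a)

theorem diagonalMeasure_univ (ξ : H) :
    diagonalMeasure hX hγ ξ univ = ENNReal.ofReal (‖ξ‖ ^ 2) := by
  have h0 : Tendsto (fun l : ℝ => (inner ℂ ξ (positiveFamily X l ξ)).re) atBot (𝓝 0) := by
    simp only [re_inner_positiveFamily]
    simpa using ((hX.isResolution.tendsto_atBot ξ).norm).pow 2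
  have h1 : Tendsto (fun l : ℝ => (inner ℂ ξ (positiveFamily X l ξ)).re) atTop (𝓝 (‖ξ‖ ^ 2)) := by
    simp only [re_inner_positiveFamily]
    exact ((hX.isResolution.tendsto_atTop ξ).norm).pow 2
  rw [diagonalMeasure, StieltjesFunction.measure_univ _ h0 h1, sub_zero]

instance isFiniteMeasure_diagonalMeasure (ξ : H) : IsFiniteMeasure (diagonalMeasure hX hγ ξ) :=
  ⟨by rw [diagonalMeasure_univ]; exact ENNReal.ofReal_lt_top⟩

theorem diagonalMeasure_Iic_toReal (ξ : H) (a : ℝ) :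
    (diagonalMeasure hX hγ ξ).real (Iic a) = ‖X a ξ‖ ^ 2 := by
  rw [Measure.real, diagonalMeasure_Iic, ENNReal.toReal_ofReal (by positivity)]

/-- The parallelogram law for `X a ξ` and `X a η`, on each half-line. It makes the domain closed
under addition. -/
theorem diagonalMeasure_add_add_diagonalMeasure_sub (ξ η : H) :
    diagonalMeasure hX hγ (ξ + η) + diagonalMeasure hX hγ (ξ - η) =
      (2 : ENNReal) • diagonalMeasure hX hγ ξ + (2 : ENNReal) • diagonalMeasure hX hγ η := by
  have : IsFiniteMeasure ((2 : ENNReal) • diagonalMeasure hX hγ ξ) :=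
    Measure.smul_finite _ (by simp)
  refine Measure.ext_of_Iic _ _ fun a => ?_
  have h2 : (2 : ENNReal) = ENNReal.ofReal 2 := by simp
  simp only [Measure.add_apply, Measure.smul_apply, diagonalMeasure_Iic, smul_eq_mul, h2, map_add,
    map_sub]
  rw [← ENNReal.ofReal_mul zero_le_two, ← ENNReal.ofReal_mul zero_le_two,
    ← ENNReal.ofReal_add (by positivity) (by positivity),
    ← ENNReal.ofReal_add (by positivity) (by positivity)]
  congr 1
  have := parallelogram_law_with_norm ℂ (X a ξ) (X a η)
  nlinarith

theorem diagonalMeasure_add_le (ξ η : H) :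
    diagonalMeasure hX hγ (ξ + η) ≤
      (2 : ENNReal) • diagonalMeasure hX hγ ξ + (2 : ENNReal) • diagonalMeasure hX hγ η :=
  (Measure.le_add_right le_rfl).trans_eq (diagonalMeasure_add_add_diagonalMeasure_sub hX hγ ξ η)

theorem diagonalMeasure_smul (c : ℂ) (ξ : H) :
    diagonalMeasure hX hγ (c • ξ) = ENNReal.ofReal (‖c‖ ^ 2) • diagonalMeasure hX hγ ξ := by
  refine Measure.ext_of_Iic _ _ fun a => ?_
  rw [Measure.smul_apply, diagonalMeasure_Iic, diagonalMeasure_Iic, smul_eq_mul,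
    ← ENNReal.ofReal_mul (by positivity), map_smul, norm_smul, mul_pow]

/-- A self-adjoint idempotent commuting with the family splits the diagonal measure. -/
theorem diagonalMeasure_eq_add_of_commute {A : H →L[ℂ] H} (hA : ∀ x, A (A x) = A x)
    (hA' : ∀ x y, inner ℂ (A x) y = inner ℂ x (A y)) (hAX : ∀ l x, X l (A x) = A (X l x)) (ξ : H) :
    diagonalMeasure hX hγ ξ = diagonalMeasure hX hγ (A ξ) + diagonalMeasure hX hγ (ξ - A ξ) := by
  refine Measure.ext_of_Iic _ _ fun a => ?_
  rw [Measure.add_apply, diagonalMeasure_Iic, diagonalMeasure_Iic, diagonalMeasure_Iic,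
    ← ENNReal.ofReal_add (by positivity) (by positivity), map_sub, hAX]
  congr 1
  have h0 : inner ℂ (A (X a ξ)) (X a ξ - A (X a ξ)) = 0 := by
    rw [hA', map_sub, hA, sub_self, inner_zero_right]
  have := norm_add_sq_eq_norm_sq_add_norm_sq_of_inner_eq_zero _ _ h0
  rw [add_sub_cancel] at this
  nlinarith

theorem mem_squareIntegrableDomain_iff (ξ : H) :
    ξ ∈ squareIntegrableDomain hX hγ ↔
      MemLp (fun x : ℝ => (x : ℂ)) 2 (diagonalMeasure hX hγ ξ) := by
  have hm : AEStronglyMeasurable (fun x : ℝ => (x : ℂ)) (diagonalMeasure hX hγ ξ) :=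
    Complex.continuous_ofReal.aestronglyMeasurable
  rw [memLp_two_iff_integrable_sq_norm hm, Integrable,
    and_iff_right (by fun_prop), hasFiniteIntegral_iff_ofReal (ae_of_all _ fun x => by positivity)]
  simp only [Complex.norm_real, Real.norm_eq_abs, sq_abs]
  rfl

/-- The isometry `L²(d⟨F ξ, ξ⟩) → H` sending the indicator of `(-∞, a]` to `X a ξ`. -/
noncomputable def spectralMap (ξ : H) : Lp ℂ 2 (diagonalMeasure hX hγ ξ) →L[ℂ] H :=
  (Finsupp.linearCombination ℂ fun a : ℝ => X a ξ).extendOfNorm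
    (Finsupp.linearCombination ℂ fun a : ℝ =>
      indicatorConstLp 2 (measurableSet_Iic (a := a))
        (measure_ne_top (diagonalMeasure hX hγ ξ) _) (1 : ℂ))

/-- The two families have the same Gram matrix, with entries `‖X (min a b) ξ‖ ^ 2`. -/
theorem norm_linearCombination_eq (ξ : H) (c : ℝ →₀ ℂ) :
    ‖Finsupp.linearCombination ℂ (fun a : ℝ => X a ξ) c‖ =
      ‖Finsupp.linearCombination ℂ (fun a : ℝ =>
      indicatorConstLp 2 (measurableSet_Iic (a := a))
        (measure_ne_top (diagonalMeasure hX hγ ξ) _) (1 : ℂ)) c‖ := by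
  rw [← sq_eq_sq₀ (norm_nonneg _) (norm_nonneg _), ← Complex.ofReal_inj]
  push_cast
  have e1 := inner_self_eq_norm_sq_to_K (𝕜 := ℂ) (Finsupp.linearCombination ℂ (fun a : ℝ => X a ξ) c)
  have e2 := inner_self_eq_norm_sq_to_K (𝕜 := ℂ) (Finsupp.linearCombination ℂ (fun a : ℝ =>
      indicatorConstLp 2 (measurableSet_Iic (a := a))
        (measure_ne_top (diagonalMeasure hX hγ ξ) _) (1 : ℂ)) c)
  refine e1.symm.trans (Eq.trans ?_ e2)
  simp only [Finsupp.linearCombination_apply, Finsupp.sum, sum_inner, inner_sum, inner_smul_left,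
    inner_smul_right]
  refine Finset.sum_congr rfl fun a _ => congrArg _ (Finset.sum_congr rfl fun b _ => congrArg _ ?_)
  rw [L2.inner_indicatorConstLp_one_indicatorConstLp_one, Iic_inter_Iic,
    diagonalMeasure_Iic_toReal, hX.isResolution.inner_apply_left hγ, hX.isResolution.apply_apply,
    hX.isResolution.inner_apply_self hγ]
  rfl

theorem spectralMap_indicator (ξ : H) (a : ℝ) :
    spectralMap hX hγ ξ (indicatorConstLp 2 (measurableSet_Iic (a := a))
        (measure_ne_top (diagonalMeasure hX hγ ξ) _) (1 : ℂ)) = X a ξ := by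
  have h := LinearMap.extendOfNorm_eq
    (denseRange_linearCombination_indicator_Iic (diagonalMeasure hX hγ ξ))
    ⟨1, fun c => by rw [one_mul, norm_linearCombination_eq hX hγ ξ c]⟩ (Finsupp.single a 1)
  rw [Finsupp.linearCombination_single, Finsupp.linearCombination_single, one_smul, one_smul] at h
  exact h

theorem norm_spectralMap (ξ : H) (h : Lp ℂ 2 (diagonalMeasure hX hγ ξ)) :
    ‖spectralMap hX hγ ξ h‖ = ‖h‖ := by
  refine (denseRange_linearCombination_indicator_Iic (diagonalMeasure hX hγ ξ)).induction_on
    (p := fun h => ‖spectralMap hX hγ ξ h‖ = ‖h‖) h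
    (isClosed_eq (by fun_prop) (by fun_prop)) fun c => ?_
  rw [spectralMap, LinearMap.extendOfNorm_eq
    (denseRange_linearCombination_indicator_Iic (diagonalMeasure hX hγ ξ))
    ⟨1, fun c => by rw [one_mul, norm_linearCombination_eq hX hγ ξ c]⟩,
    norm_linearCombination_eq hX hγ ξ c]

/-- Continuous linear maps on `L²` are determined by the indicators of the half-lines. -/
theorem MeasureTheory.clm_ext_indicator_Iic {E : Type*} [NormedAddCommGroup E] [NormedSpace ℂ E]
    {μ : Measure ℝ} [IsFiniteMeasure μ] {S T : Lp ℂ 2 μ →L[ℂ] E}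
    (h : ∀ a : ℝ, S (indicatorConstLp 2 (measurableSet_Iic (a := a)) (measure_ne_top μ _) 1) =
      T (indicatorConstLp 2 (measurableSet_Iic (a := a)) (measure_ne_top μ _) 1)) : S = T := by
  ext k
  refine (denseRange_linearCombination_indicator_Iic μ).induction_on
    (p := fun k => S k = T k) k (isClosed_eq (by fun_prop) (by fun_prop)) fun c => ?_
  simp only [Finsupp.linearCombination_apply, Finsupp.sum, map_sum, map_smul, h]

theorem MeasureTheory.Lp.restrictMeasure_indicator {μ ν : Measure ℝ} [IsFiniteMeasure μ]
    [IsFiniteMeasure ν] (h : ν ≤ μ) (a : ℝ) :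
    Lp.restrictMeasure h (indicatorConstLp 2 (measurableSet_Iic (a := a)) (measure_ne_top μ _) 1) =
      indicatorConstLp 2 (measurableSet_Iic (a := a)) (measure_ne_top ν _) 1 :=
  Lp.restrictMeasure_toLp h _

end Diagonal

/-! ### The spectral operator and its symmetry. -/

section Operator

open Set

variable {H : Type*} [NormedAddCommGroup H] [InnerProductSpace ℂ H] [CompleteSpace H]
  {X : ℝ → H →L[ℂ] H} (hX : IsStarResolutionOfIdentity X) (hγ : resolutionBound X = 1)

theorem MeasureTheory.MemLp.two_add_measure {μ ν : Measure ℝ} {h : ℝ → ℂ} (h1 : MemLp h 2 μ)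
    (h2 : MemLp h 2 ν) : MemLp h 2 (μ + ν) := by
  have hm := h1.aestronglyMeasurable.add_measure h2.aestronglyMeasurable
  exact (memLp_two_iff_integrable_sq_norm hm).2
    (((memLp_two_iff_integrable_sq_norm h1.aestronglyMeasurable).1 h1).add_measure
      ((memLp_two_iff_integrable_sq_norm h2.aestronglyMeasurable).1 h2))

/-- The three `L²` spaces differ, so everything is pulled back to `L²` of a measure dominating all
three, where both sides are continuous and agree on half-lines. -/
theorem spectralMap_add (ξ η : H) {h : ℝ → ℂ} (h1 : MemLp h 2 (diagonalMeasure hX hγ ξ))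
    (h2 : MemLp h 2 (diagonalMeasure hX hγ η))
    (h3 : MemLp h 2 (diagonalMeasure hX hγ (ξ + η))) :
    spectralMap hX hγ (ξ + η) (h3.toLp h) =
      spectralMap hX hγ ξ (h1.toLp h) + spectralMap hX hγ η (h2.toLp h) := by
  set μ := diagonalMeasure hX hγ ξ + diagonalMeasure hX hγ η + diagonalMeasure hX hγ (ξ + η)
  have l1 : diagonalMeasure hX hγ ξ ≤ μ := (Measure.le_add_right le_rfl).trans (Measure.le_add_right le_rfl)
  have l2 : diagonalMeasure hX hγ η ≤ μ := (Measure.le_add_left le_rfl).trans (Measure.le_add_right le_rfl)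
  have l3 : diagonalMeasure hX hγ (ξ + η) ≤ μ := Measure.le_add_left le_rfl
  have hμ : MemLp h 2 μ := (h1.two_add_measure h2).two_add_measure h3
  have key : (spectralMap hX hγ (ξ + η)).comp (Lp.restrictMeasure l3) =
      (spectralMap hX hγ ξ).comp (Lp.restrictMeasure l1) +
        (spectralMap hX hγ η).comp (Lp.restrictMeasure l2) := by
    refine clm_ext_indicator_Iic fun a => ?_
    simp only [_root_.add_apply, ContinuousLinearMap.comp_apply,
      Lp.restrictMeasure_indicator, spectralMap_indicator, map_add]
  have := congrArg (fun S => S (hμ.toLp h)) key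
  simpa only [_root_.add_apply, ContinuousLinearMap.comp_apply,
    Lp.restrictMeasure_toLp] using this

/-- A bounded operator commuting with the family commutes with the spectral map. -/
theorem spectralMap_apply_of_commute {A : H →L[ℂ] H} (hAX : ∀ l x, X l (A x) = A (X l x)) (ξ : H)
    {h : ℝ → ℂ} (h1 : MemLp h 2 (diagonalMeasure hX hγ ξ))
    (h2 : MemLp h 2 (diagonalMeasure hX hγ (A ξ))) :
    spectralMap hX hγ (A ξ) (h2.toLp h) = A (spectralMap hX hγ ξ (h1.toLp h)) := by
  set μ := diagonalMeasure hX hγ ξ + diagonalMeasure hX hγ (A ξ)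
  have l1 : diagonalMeasure hX hγ ξ ≤ μ := Measure.le_add_right le_rfl
  have l2 : diagonalMeasure hX hγ (A ξ) ≤ μ := Measure.le_add_left le_rfl
  have hμ : MemLp h 2 μ := h1.two_add_measure h2
  have key : (spectralMap hX hγ (A ξ)).comp (Lp.restrictMeasure l2) =
      A.comp ((spectralMap hX hγ ξ).comp (Lp.restrictMeasure l1)) := by
    refine clm_ext_indicator_Iic fun a => ?_
    simp only [ContinuousLinearMap.comp_apply, Lp.restrictMeasure_indicator,
      spectralMap_indicator, hAX]
  have := congrArg (fun S => S (hμ.toLp h)) key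
  simpa only [ContinuousLinearMap.comp_apply, Lp.restrictMeasure_toLp] using this

/-- The domain of the spectral integral as a subspace. -/
def spectralDomain : Submodule ℂ H where
  carrier := squareIntegrableDomain hX hγ
  zero_mem' := by
    have h := diagonalMeasure_smul hX hγ 0 (0 : H)
    rw [zero_smul, norm_zero, zero_pow two_ne_zero, ENNReal.ofReal_zero, zero_smul] at h
    rw [mem_squareIntegrableDomain_iff, h]
    simp
  add_mem' := by
    intro ξ η h1 h2
    rw [mem_squareIntegrableDomain_iff] at *
    exact ((h1.smul_measure ENNReal.ofNat_ne_top).two_add_measure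
      (h2.smul_measure ENNReal.ofNat_ne_top)).mono_measure
      (diagonalMeasure_add_le hX hγ ξ η)
  smul_mem' := by
    intro c ξ h1
    rw [mem_squareIntegrableDomain_iff] at *
    rw [diagonalMeasure_smul]
    exact h1.smul_measure (by simp)

theorem memLp_of_mem_spectralDomain {ξ : H} (h : ξ ∈ spectralDomain hX hγ) :
    MemLp (fun x : ℝ => (x : ℂ)) 2 (diagonalMeasure hX hγ ξ) :=
  (mem_squareIntegrableDomain_iff hX hγ ξ).1 h

/-- The operator `∫ l dF(l)`. -/
noncomputable def spectralOperator : H →ₗ.[ℂ] H where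
  domain := spectralDomain hX hγ
  toFun :=
    { toFun := fun ξ =>
        spectralMap hX hγ ξ ((memLp_of_mem_spectralDomain hX hγ ξ.2).toLp (fun x : ℝ => (x : ℂ)))
      map_add' := fun ξ η => spectralMap_add hX hγ ξ η _ _ _
      map_smul' := fun c ξ => spectralMap_apply_of_commute hX hγ
        (A := c • ContinuousLinearMap.id ℂ H) (fun l x => by simp) ξ _ _ }

theorem spectralOperator_apply (ξ : (spectralOperator hX hγ).domain) :
    spectralOperator hX hγ ξ =
      spectralMap hX hγ ξ ((memLp_of_mem_spectralDomain hX hγ ξ.2).toLp (fun x : ℝ => (x : ℂ))) :=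
  rfl

theorem norm_spectralOperator_sq (ξ : (spectralOperator hX hγ).domain) :
    ENNReal.ofReal (‖spectralOperator hX hγ ξ‖ ^ 2) =
      ∫⁻ l : ℝ, ENNReal.ofReal (l ^ 2) ∂(diagonalMeasure hX hγ ξ) := by
  have hm := memLp_of_mem_spectralDomain hX hγ ξ.2
  rw [spectralOperator_apply, norm_spectralMap, Lp.norm_toLp,
    ENNReal.ofReal_pow ENNReal.toReal_nonneg, ENNReal.ofReal_toReal hm.2.ne]
  have h := eLpNorm_nnreal_pow_eq_lintegral (p := 2) (f := fun x : ℝ => (x : ℂ))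
    (μ := diagonalMeasure hX hγ ξ) two_ne_zero
  simp only [NNReal.coe_ofNat, ENNReal.coe_ofNat, ENNReal.rpow_ofNat] at h
  rw [h]
  refine lintegral_congr fun x => ?_
  rw [← ofReal_norm, ← ENNReal.ofReal_pow (norm_nonneg _), Complex.norm_real,
    Real.norm_eq_abs, sq_abs]

/-- Pairing `spectralMap` with `ξ` itself is integration against `μ_ξ`, and the integrand `x` is
real. -/
theorem inner_spectralOperator_self (ξ : (spectralOperator hX hγ).domain) :
    (inner ℂ (ξ : H) (spectralOperator hX hγ ξ)).im = 0 := by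
  set μ := diagonalMeasure hX hγ ξ
  have hm := memLp_of_mem_spectralDomain hX hγ ξ.2
  have key : (innerSL ℂ (ξ : H)).comp (spectralMap hX hγ ξ) =
      innerSL ℂ (indicatorConstLp 2 .univ (measure_ne_top μ _) (1 : ℂ)) := by
    refine clm_ext_indicator_Iic fun a => ?_
    rw [ContinuousLinearMap.comp_apply, spectralMap_indicator, innerSL_apply_apply, innerSL_apply_apply,
      L2.inner_indicatorConstLp_one_indicatorConstLp_one, univ_inter, diagonalMeasure_Iic_toReal,
      hX.isResolution.inner_apply_self hγ]
    rfl
  have h := congrArg (fun S => S (hm.toLp _)) key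
  simp only [ContinuousLinearMap.comp_apply, innerSL_apply_apply] at h
  rw [L2.inner_indicatorConstLp_one, setIntegral_univ, integral_congr_ae hm.coeFn_toLp,
    integral_complex_ofReal] at h
  rw [spectralOperator_apply, h]
  exact Complex.ofReal_im _

/-- Complex polarization of the real quadratic form, at `x + y` and `x + i y`. -/
theorem isFormalAdjoint_spectralOperator :
    (spectralOperator hX hγ).IsFormalAdjoint (spectralOperator hX hγ) := by
  set T := spectralOperator hX hγ
  intro x y
  have hT : ∀ z : T.domain, inner ℂ (T z) (z : H) = inner ℂ (z : H) (T z) := by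
    intro z
    rw [← inner_conj_symm, Complex.conj_eq_iff_im]
    exact inner_spectralOperator_self hX hγ z
  have h1 := hT (x + y)
  have h2 := hT (x + Complex.I • y)
  simp only [LinearPMap.map_add, LinearPMap.map_smul, Submodule.coe_add, Submodule.coe_smul, inner_add_left,
    inner_add_right, inner_smul_left, inner_smul_right, hT, Complex.conj_I] at h1 h2
  have h3 : Complex.I * (inner ℂ (T x) (y : H) - inner ℂ (x : H) (T y)) = 
     Complex.I * (inner ℂ (T y) (x : H) - inner ℂ (y : H) (T x)) := by
    linear_combination h2
  have h4 := mul_left_cancel₀ Complex.I_ne_zero h3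
  linear_combination (1 / 2 : ℂ) * h1 + (1 / 2 : ℂ) * h4

end Operator

/-! ### Truncations, density of the domain and self-adjointness. -/

section Truncation

open Set

variable {H : Type*} [NormedAddCommGroup H] [InnerProductSpace ℂ H]

/-- The spectral projection `X(n) - X(-n)` of the interval `(-n, n]`. -/
def spectralTruncation (X : ℝ → H →L[ℂ] H) (n : ℕ) : H →L[ℂ] H := X n - X (-n)

variable {X : ℝ → H →L[ℂ] H}

theorem spectralTruncation_apply (n : ℕ) (ξ : H) : spectralTruncation X n ξ = X n ξ - X (-n) ξ := rfl

theorem apply_neg_spectralTruncation (hX : IsResolutionOfIdentity X) (n : ℕ) (ξ : H) :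
    X (-n) (spectralTruncation X n ξ) = 0 := by
  have h : -(n : ℝ) ≤ n := neg_le_self (Nat.cast_nonneg n)
  simp [spectralTruncation_apply, hX.apply_apply, h]

theorem apply_spectralTruncation (hX : IsResolutionOfIdentity X) (n : ℕ) (ξ : H) :
    X n (spectralTruncation X n ξ) = spectralTruncation X n ξ := by
  have h : -(n : ℝ) ≤ n := neg_le_self (Nat.cast_nonneg n)
  simp [spectralTruncation_apply, hX.apply_apply, h]

theorem spectralTruncation_idem (hX : IsResolutionOfIdentity X) (n : ℕ) (ξ : H) :
    spectralTruncation X n (spectralTruncation X n ξ) = spectralTruncation X n ξ := by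
  rw [spectralTruncation_apply, apply_neg_spectralTruncation hX, apply_spectralTruncation hX,
    sub_zero]

theorem spectralTruncation_commute (hX : IsResolutionOfIdentity X) (n : ℕ) (l : ℝ) (ξ : H) :
    X l (spectralTruncation X n ξ) = spectralTruncation X n (X l ξ) := by
  simp only [spectralTruncation_apply, map_sub, hX.apply_apply, min_comm]

theorem inner_spectralTruncation_left (hX : IsResolutionOfIdentity X)
    (hγ : resolutionBound X = 1) (n : ℕ) (ξ η : H) :
    inner ℂ (spectralTruncation X n ξ) η = inner ℂ ξ (spectralTruncation X n η) := by
  simp only [spectralTruncation_apply, inner_sub_left, inner_sub_right, hX.inner_apply_left hγ]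

theorem tendsto_spectralTruncation (hX : IsResolutionOfIdentity X) (ξ : H) :
    Tendsto (fun n : ℕ => spectralTruncation X n ξ) atTop (𝓝 ξ) := by
  have h1 := (hX.tendsto_atTop ξ).comp tendsto_natCast_atTop_atTop
  have h2 := (hX.tendsto_atBot ξ).comp
    (tendsto_neg_atTop_atBot.comp (tendsto_natCast_atTop_atTop (R := ℝ)))
  simpa [spectralTruncation_apply] using h1.sub h2

theorem norm_spectralTruncation_le (hX : IsResolutionOfIdentity X)
    (hγ : resolutionBound X = 1) (n : ℕ) (ξ : H) : ‖spectralTruncation X n ξ‖ ≤ ‖ξ‖ := by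
  have h : ‖spectralTruncation X n ξ‖ ^ 2 ≤ ‖ξ‖ * ‖spectralTruncation X n ξ‖ := by
    have h1 := inner_self_eq_norm_sq_to_K (𝕜 := ℂ) (spectralTruncation X n ξ)
    rw [inner_spectralTruncation_left hX hγ, spectralTruncation_idem hX] at h1
    have h2 := norm_inner_le_norm (𝕜 := ℂ) ξ (spectralTruncation X n ξ)
    rw [h1] at h2
    simpa using h2
  rcases (norm_nonneg (spectralTruncation X n ξ)).eq_or_lt with h0 | h0
  · rw [← h0]; exact norm_nonneg ξ
  · rw [sq] at h
    exact le_of_mul_le_mul_right h h0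

variable [CompleteSpace H] (hX : IsStarResolutionOfIdentity X) (hγ : resolutionBound X = 1)

/-- The diagonal measure of a truncated vector is carried by `(-n, n]`, where `x` is bounded. -/
theorem spectralTruncation_mem_spectralDomain (n : ℕ) (ξ : H) :
    spectralTruncation X n ξ ∈ spectralDomain hX hγ := by
  set μ := diagonalMeasure hX hγ (spectralTruncation X n ξ) with hμ
  have h1 : μ (Iic (-n : ℝ)) = 0 := by
    rw [hμ, diagonalMeasure_Iic, apply_neg_spectralTruncation hX.isResolution]
    simp
  have h2 : μ (Ioi (n : ℝ)) = 0 := by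
    rw [← compl_Iic, measure_compl measurableSet_Iic (measure_ne_top _ _), hμ, diagonalMeasure_univ,
      diagonalMeasure_Iic, apply_spectralTruncation hX.isResolution, tsub_self]
  refine (mem_squareIntegrableDomain_iff hX hγ _).2 (MemLp.of_bound
    Complex.continuous_ofReal.aestronglyMeasurable n ?_)
  filter_upwards [measure_eq_zero_iff_ae_notMem.1 h1, measure_eq_zero_iff_ae_notMem.1 h2]
    with x hx1 hx2
  rw [Complex.norm_real, Real.norm_eq_abs, abs_le]
  rw [mem_Iic, not_le] at hx1
  rw [mem_Ioi, not_lt] at hx2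
  exact ⟨hx1.le, hx2⟩

theorem dense_spectralDomain : Dense (spectralDomain hX hγ : Set H) := fun ξ =>
  mem_closure_of_tendsto (tendsto_spectralTruncation hX.isResolution ξ)
    (Eventually.of_forall fun n => spectralTruncation_mem_spectralDomain hX hγ n ξ)

theorem diagonalMeasure_eq_add_spectralTruncation (n : ℕ) (ξ : H) :
    diagonalMeasure hX hγ ξ = diagonalMeasure hX hγ (spectralTruncation X n ξ) +
      diagonalMeasure hX hγ (ξ - spectralTruncation X n ξ) :=
  diagonalMeasure_eq_add_of_commute hX hγ (spectralTruncation_idem hX.isResolution n)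
    (inner_spectralTruncation_left hX.isResolution hγ n)
    (spectralTruncation_commute hX.isResolution n) ξ

theorem diagonalMeasure_sub_spectralTruncation_Ioc (n : ℕ) (ξ : H) :
    diagonalMeasure hX hγ (ξ - spectralTruncation X n ξ) (Ioc (-n) n) = 0 := by
  have h : -(n : ℝ) ≤ n := neg_le_self (Nat.cast_nonneg n)
  rw [← Iic_sdiff_Iic, measure_sdiff (Iic_subset_Iic.2 h) measurableSet_Iic.nullMeasurableSet
    (measure_ne_top _ _), diagonalMeasure_Iic, diagonalMeasure_Iic, map_sub, map_sub,
    apply_spectralTruncation hX.isResolution, apply_neg_spectralTruncation hX.isResolution,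
    spectralTruncation_apply]
  simp

/-- On `(-n, n]` the measures of `ξ` and of its truncation coincide, the remainder having no mass
there. -/
theorem setLIntegral_diagonalMeasure_le (n : ℕ) (ξ : H) :
    ∫⁻ l in Ioc (-n : ℝ) n, ENNReal.ofReal (l ^ 2) ∂(diagonalMeasure hX hγ ξ) ≤
      ENNReal.ofReal (‖spectralOperator hX hγ
        ⟨_, spectralTruncation_mem_spectralDomain hX hγ n ξ⟩‖ ^ 2) := by
  rw [norm_spectralOperator_sq, diagonalMeasure_eq_add_spectralTruncation hX hγ n ξ,
    Measure.restrict_add, lintegral_add_measure,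
    Measure.restrict_eq_zero.2 (diagonalMeasure_sub_spectralTruncation_Ioc hX hγ n ξ),
    lintegral_zero_measure, add_zero]
  exact lintegral_mono' Measure.restrict_le_self le_rfl

theorem spectralOperator_spectralTruncation (n : ℕ) (ξ : (spectralOperator hX hγ).domain) :
    spectralOperator hX hγ ⟨_, spectralTruncation_mem_spectralDomain hX hγ n ξ⟩ =
      spectralTruncation X n (spectralOperator hX hγ ξ) :=
  spectralMap_apply_of_commute hX hγ (spectralTruncation_commute hX.isResolution n) ξ _ _

/-- The integrals of `l²` over `(-n, n]` are at most `C²` and converge to the full integral. -/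
theorem mem_spectralDomain_of_norm_le {ξ : H} {C : ℝ}
    (h : ∀ n : ℕ, ‖spectralOperator hX hγ
        ⟨_, spectralTruncation_mem_spectralDomain hX hγ n ξ⟩‖ ≤ C) :
    ξ ∈ spectralDomain hX hγ := by
  have hcov : AECover (diagonalMeasure hX hγ ξ) atTop fun n : ℕ => Ioc (-n : ℝ) n :=
    aecover_Ioc (tendsto_neg_atTop_atBot.comp tendsto_natCast_atTop_atTop)
      tendsto_natCast_atTop_atTop
  have hlim := hcov.lintegral_tendsto_of_nat (f := fun l => ENNReal.ofReal (l ^ 2))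
    (by fun_prop)
  refine lt_of_le_of_lt (le_of_tendsto' hlim fun n =>
    (setLIntegral_diagonalMeasure_le hX hγ n ξ).trans (b := _) (c := ENNReal.ofReal (C ^ 2)) ?_)
    ENNReal.ofReal_lt_top
  refine ENNReal.ofReal_le_ofReal ?_
  have := h n
  gcongr

open LinearPMap in
/-- The spectral operator is self-adjoint. -/
theorem adjoint_spectralOperator : (spectralOperator hX hγ)† = spectralOperator hX hγ := by
  set T := spectralOperator hX hγ
  have hd : Dense (T.domain : Set H) := dense_spectralDomain hX hγ
  have hle : T ≤ T† := (isFormalAdjoint_spectralOperator hX hγ).le_adjoint hd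
  refine (eq_of_le_of_domain_eq hle (le_antisymm hle.1 fun η hη => ?_)).symm
  refine mem_spectralDomain_of_norm_le hX hγ (C := ‖T† ⟨η, hη⟩‖) fun n => ?_
  suffices h : spectralOperator hX hγ ⟨_, spectralTruncation_mem_spectralDomain hX hγ n η⟩ =
      spectralTruncation X n (T† ⟨η, hη⟩) by
    rw [h]
    exact norm_spectralTruncation_le hX.isResolution hγ n _
  refine ext_inner_right ℂ fun ξ => ?_
  set E : H → T.domain := fun ζ => ⟨_, spectralTruncation_mem_spectralDomain hX hγ n ζ⟩
  -- `T` preserves the range of the truncation, so the self-adjoint projection can be moved across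
  -- the inner product at will.
  have hE : ∀ ζ, T (E ζ) = spectralTruncation X n (T (E ζ)) := by
    intro ζ
    exact (congrArg T (Subtype.ext (spectralTruncation_idem hX.isResolution n ζ).symm)).trans
      (spectralOperator_spectralTruncation hX hγ n (E ζ))
  have hsym := inner_spectralTruncation_left hX.isResolution hγ n
  calc inner ℂ (T (E η)) ξ = inner ℂ (T (E η)) (E ξ : H) :=
      (congrArg (fun z => inner ℂ z ξ) (hE η)).trans (hsym _ _)
    _ = inner ℂ (E η : H) (T (E ξ)) := isFormalAdjoint_spectralOperator hX hγ (E η) (E ξ)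
    _ = inner ℂ η (T (E ξ)) := (hsym _ _).trans (congrArg (inner ℂ η) (hE ξ).symm)
    _ = inner ℂ (T† ⟨η, hη⟩) (E ξ : H) := (adjoint_isFormalAdjoint hd ⟨η, hη⟩ (E ξ)).symm
    _ = inner ℂ (spectralTruncation X n (T† ⟨η, hη⟩)) ξ := (hsym _ _).symm

end Truncation

/-! ### The complex measures `d⟨Fξ, η⟩` and the integral formula. -/

section Stieltjes

open Set

variable {H : Type*} [NormedAddCommGroup H] [InnerProductSpace ℂ H] {X : ℝ → H →L[ℂ] H}

theorem norm_sub_sq_eq_of_le (hX : IsResolutionOfIdentity X) (hγ : resolutionBound X = 1)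
    {l m : ℝ} (h : l ≤ m) (ξ : H) : ‖X m ξ - X l ξ‖ ^ 2 = ‖X m ξ‖ ^ 2 - ‖X l ξ‖ ^ 2 := by
  have h0 : inner ℂ (X l ξ) (X m ξ - X l ξ) = 0 := by
    rw [hX.inner_apply_left hγ, map_sub, hX.apply_apply, hX.apply_apply, min_eq_left h, min_self,
      sub_self, inner_zero_right]
  have := norm_add_sq_eq_norm_sq_add_norm_sq_of_inner_eq_zero _ _ h0
  rw [add_sub_cancel] at this
  nlinarith

/-- `X m - X l` is an orthogonal projection, so Cauchy–Schwarz and `ab ≤ a² + b²` apply. The bound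
is the increment of a bounded monotone function. -/
theorem norm_inner_sub_le (hX : IsResolutionOfIdentity X) (hγ : resolutionBound X = 1)
    {l m : ℝ} (h : l ≤ m) (ξ η : H) :
    ‖(inner ℂ η (X m ξ) - inner ℂ η (X l ξ) : ℂ)‖ ≤
      (‖X m ξ‖ ^ 2 + ‖X m η‖ ^ 2) - (‖X l ξ‖ ^ 2 + ‖X l η‖ ^ 2) := by
  have h1 : (inner ℂ η (X m ξ) - inner ℂ η (X l ξ) : ℂ) =
      inner ℂ (X m η - X l η) (X m ξ - X l ξ) := by
    simp only [inner_sub_left, inner_sub_right, hX.inner_apply_left hγ, hX.apply_apply, min_self,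
      min_eq_left h, min_eq_right h]
    ring
  rw [h1]
  refine (norm_inner_le_norm _ _).trans ?_
  have h2 := norm_sub_sq_eq_of_le hX hγ h ξ
  have h3 := norm_sub_sq_eq_of_le hX hγ h η
  nlinarith [sq_nonneg (‖X m η - X l η‖ - ‖X m ξ - X l ξ‖), sq_nonneg ‖X m η - X l η‖,
    sq_nonneg ‖X m ξ - X l ξ‖]

theorem boundedVariationOn_inner_apply (hX : IsResolutionOfIdentity X)
    (hγ : resolutionBound X = 1) (ξ η : H) :
    BoundedVariationOn (fun l : ℝ => (inner ℂ η (X l ξ) : ℂ)) univ := by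
  have hle : ∀ l (ζ : H), ‖X l ζ‖ ^ 2 ≤ ‖ζ‖ ^ 2 := by
    intro l ζ
    have h1 : ‖X l‖ ≤ 1 := hγ ▸ le_ciSup hX.bddAbove_norm l
    have := ((X l).le_of_opNorm_le h1 ζ).trans_eq (one_mul _)
    gcongr
  refine BoundedVariationOn.of_norm_sub_le (G := fun l => ‖X l ξ‖ ^ 2 + ‖X l η‖ ^ 2)
    (C := ‖ξ‖ ^ 2 + ‖η‖ ^ 2) (fun l m h => ?_) (fun l => ?_)
    fun l m h => norm_inner_sub_le hX hγ h ξ η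
  · exact sub_nonneg.1 ((norm_nonneg _).trans (norm_inner_sub_le hX hγ h ξ η))
  · rw [abs_of_nonneg (by positivity)]
    exact add_le_add (hle l ξ) (hle l η)

theorem continuousWithinAt_apply (hX : IsResolutionOfIdentity X) (ξ : H) (a : ℝ) :
    ContinuousWithinAt (fun l => X l ξ) (Ioi a) a := by
  have h1 : Tendsto (fun m : ℝ => m - a) (𝓝[>] a) (𝓝[>] 0) := by
    refine tendsto_nhdsWithin_iff.2 ⟨?_, ?_⟩
    · have : Tendsto (fun m : ℝ => m - a) (𝓝 a) (𝓝 (a - a)) :=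
        (continuous_id.sub continuous_const).tendsto a
      rw [sub_self] at this
      exact this.mono_left nhdsWithin_le_nhds
    · filter_upwards [self_mem_nhdsWithin] with m hm using sub_pos.2 (mem_Ioi.1 hm)
  simpa [ContinuousWithinAt, Function.comp_def] using (hX.right_continuous a ξ).comp h1

variable [CompleteSpace H] (hX : IsStarResolutionOfIdentity X) (hγ : resolutionBound X = 1)

/-- The density of `d⟨F ξ, η⟩` with respect to `d⟨F ξ, ξ⟩`. -/
noncomputable def spectralDensity (ξ η : H) : ℝ → ℂ := fun x =>
  -- The conjugate appears because `inner` is conjugate-linear in its first argument.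
  (starRingEnd ℂ) (ContinuousLinearMap.adjoint (spectralMap hX hγ ξ) η x)

theorem memLp_spectralDensity (ξ η : H) :
    MemLp (spectralDensity hX hγ ξ η) 2 (diagonalMeasure hX hγ ξ) :=
  (Lp.memLp (ContinuousLinearMap.adjoint (spectralMap hX hγ ξ) η)).star

theorem inner_spectralMap (ξ η : H) {h : ℝ → ℂ} (hh : MemLp h 2 (diagonalMeasure hX hγ ξ)) :
    inner ℂ η (spectralMap hX hγ ξ (hh.toLp h)) =
      ∫ x, h x * spectralDensity hX hγ ξ η x ∂(diagonalMeasure hX hγ ξ) := by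
  rw [← ContinuousLinearMap.adjoint_inner_left, L2.inner_def]
  refine integral_congr_ae ?_
  filter_upwards [hh.coeFn_toLp] with x hx
  rw [hx]
  rfl

theorem integrable_spectralDensity (ξ η : H) :
    Integrable (spectralDensity hX hγ ξ η) (diagonalMeasure hX hγ ξ) :=
  (memLp_spectralDensity hX hγ ξ η).integrable (by norm_num)

theorem setIntegral_spectralDensity (ξ η : H) (a : ℝ) :
    ∫ x in Iic a, spectralDensity hX hγ ξ η x ∂(diagonalMeasure hX hγ ξ) =
      inner ℂ η (X a ξ) := by
  have h := inner_spectralMap hX hγ ξ η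
    (memLp_indicator_const 2 (measurableSet_Iic (a := a)) (1 : ℂ)
      (Or.inr (measure_ne_top (diagonalMeasure hX hγ ξ) _)))
  rw [← spectralMap_indicator hX hγ ξ a]
  refine Eq.trans ?_ h.symm
  rw [← integral_indicator measurableSet_Iic]
  congr 1 with x
  by_cases hx : x ∈ Iic a <;> simp [hx]

/-- Both measures give `Iic a` the mass `inner ℂ η (X a ξ)`, by right continuity and the zero limit
at `-∞`. -/
theorem vectorMeasure_inner_apply (ξ η : H)
    (hf : BoundedVariationOn (fun l : ℝ => (inner ℂ η (X l ξ) : ℂ)) univ) :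
    hf.vectorMeasure =
      (diagonalMeasure hX hγ ξ).withDensityᵥ (spectralDensity hX hγ ξ η) := by
  have hi := integrable_spectralDensity hX hγ ξ η
  have hbot : limUnder atBot (fun l : ℝ => (inner ℂ η (X l ξ) : ℂ)) = 0 := by
    refine Tendsto.limUnder_eq ?_
    simpa using (tendsto_const_nhds (x := η)).inner (𝕜 := ℂ) (hX.isResolution.tendsto_atBot ξ)
  have hIic : ∀ a : ℝ, hf.vectorMeasure (Iic a) =
      (diagonalMeasure hX hγ ξ).withDensityᵥ (spectralDensity hX hγ ξ η) (Iic a) := by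
    intro a
    rw [hf.vectorMeasure_Iic, hbot, sub_zero, withDensityᵥ_apply hi measurableSet_Iic,
      setIntegral_spectralDensity]
    exact ContinuousWithinAt.rightLim_eq
      (ContinuousWithinAt.inner (𝕜 := ℂ) continuousWithinAt_const
        (continuousWithinAt_Ioi_iff_Ici.1 (continuousWithinAt_apply hX.isResolution ξ a)))
  refine VectorMeasure.ext_of_generateFrom (range Iic) ?_
    ((BorelSpace.measurable_eq (α := ℝ)).trans (borel_eq_generateFrom_Iic ℝ)) isPiSystem_Iic ?_
  · rintro _ ⟨a, rfl⟩
    exact hIic a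
  · have hU : ⋃ n : ℕ, Iic (n : ℝ) = univ := by
      refine eq_univ_of_forall fun x => ?_
      obtain ⟨n, hn⟩ := exists_nat_ge x
      exact mem_iUnion.2 ⟨n, hn⟩
    have hlim : ∀ v : VectorMeasure ℝ ℂ,
        Tendsto (fun n : ℕ => v (Iic (n : ℝ))) atTop (𝓝 (v univ)) := by
      intro v
      rw [← hU]
      exact VectorMeasure.tendsto_vectorMeasure_iUnion_atTop_nat
        (fun m n hmn => Iic_subset_Iic.2 (by exact_mod_cast hmn)) fun _ => measurableSet_Iic
    have h1 := hlim hf.vectorMeasure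
    simp only [hIic] at h1
    exact tendsto_nhds_unique h1 (hlim _)

theorem hasStieltjesIntegral_spectralOperator (ξ : (spectralOperator hX hγ).domain) (η : H) :
    HasStieltjesIntegral (fun l : ℝ => l)
      (fun l : ℝ => inner ℂ η (positiveFamily X l (ξ : H)))
      (inner ℂ η (spectralOperator hX hγ ξ)) := by
  simp only [hX.isResolution.positiveFamily_apply hγ]
  have hi := integrable_spectralDensity hX hγ (ξ : H) η
  have hm := memLp_of_mem_spectralDomain hX hγ ξ.2
  refine ⟨boundedVariationOn_inner_apply hX.isResolution hγ ξ η, ?_⟩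
  rw [vectorMeasure_inner_apply hX hγ]
  have hint : ((diagonalMeasure hX hγ ξ).withDensityᵥ
      (spectralDensity hX hγ ξ η)).Integrable (fun l : ℝ => l) := by
    rw [integrable_withDensityᵥ_iff hi]
    have hm' : MemLp (fun x : ℝ => x) 2 (diagonalMeasure hX hγ ξ) := hm.re
    -- Density and coordinate are both in `L²(μ_ξ)`, so their product is integrable.
    exact (memLp_spectralDensity hX hγ (ξ : H) η).norm.integrable_mul hm'
  refine ⟨hint, ?_⟩
  rw [integral_withDensityᵥ hi hint, spectralOperator_apply, inner_spectralMap]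
  simp only [Complex.real_smul]

/-- By proof irrelevance the two bounded-variation witnesses define the same measure. -/
theorem HasStieltjesIntegral.unique {g : ℝ → ℝ} {f : ℝ → ℂ} {z w : ℂ}
    (hz : HasStieltjesIntegral g f z) (hw : HasStieltjesIntegral g f w) : z = w :=
  hz.choose_spec.2.symm.trans hw.choose_spec.2

end Stieltjes

/-! ### Existence and uniqueness. -/

theorem mainTheorem3 {H : Type*} [NormedAddCommGroup H] [InnerProductSpace ℂ H] [CompleteSpace H]
    (X : ℝ → H →L[ℂ] H) (hX : IsStarResolutionOfIdentity X) (hγ : resolutionBound X = 1) :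
    Dense (squareIntegrableDomain hX hγ) ∧
      ∃! T : H →ₗ.[ℂ] H,
        (T.domain : Set H) = squareIntegrableDomain hX hγ ∧
        T.IsClosed ∧
        IsSymmetricOperator T ∧
        ∀ (ξ : T.domain) (η : H),
          HasStieltjesIntegral (fun l : ℝ => l)
            (fun l : ℝ => inner ℂ η (positiveFamily X l (ξ : H))) (inner ℂ η (T ξ)) := by
  have hd := dense_spectralDomain hX hγ
  refine ⟨hd, spectralOperator hX hγ, ⟨rfl, ?_, ⟨hd, isFormalAdjoint_spectralOperator hX hγ⟩,
    hasStieltjesIntegral_spectralOperator hX hγ⟩, ?_⟩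
  · exact IsSelfAdjoint.isClosed (adjoint_spectralOperator hX hγ)
  · rintro S ⟨hS, -, -, hSint⟩
    refine LinearPMap.ext (SetLike.coe_injective hS) fun x hx hx' =>
      ext_inner_left ℂ fun η => ?_
    exact (hSint ⟨x, hx⟩ η).unique (hasStieltjesIntegral_spectralOperator hX hγ ⟨x, hx'⟩ η)
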